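/- Let $n\ge 0$ agents and $m\ge 1$ statements be given, let $A\in\mathbb R^{n\times n}$ and $C\in\mathbb R^{m\times m}$ be row-stochastic (nonnegative entries, each row summing to $1$), let $\lambda^1,\dots,\lambda^n\in[0,1]$, and put $\Lambda=\mathrm{diag}(\lambda^1,\dots,\lambda^n)$. The social graph $\mathcal G$ has the agents as nodes and an edge from $j$ to $i$ exactly when $A_{ij}>0$; the logic-constraint graph $\mathcal T$ has the statements as nodes and an edge from $v$ to $u$ exactly when $C_{uv}>0$. Consider the belief system $$x_{k+1}=Px_k,\qquad P=\begin{pmatrix}(\Lambda A)\otimes C & (I_n-\Lambda)\otimes I_m\\ 0 & I_{nm}\end{pmatrix}.$$ It *converges to equilibrium* if $\lim_{k\to\infty}x_k$ exists for every initial state $x_0\in[0,1]^{2nm}$. An agent $i$ is *stubborn* if $\lambda^i<1$, and *oblivious* if $\lambda^i=1$ and there is no directed path in $\mathcal G$ from a stubborn agent to $i$. A strongly connected component of a directed graph is *closed* if no edge enters it from outside, and *aperiodic* if the greatest common divisor of the lengths of all cycles (closed walks of positive length) inside it is $1$. **Theorem.** Suppose that there is at least one oblivious agent. Then the belief system converges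 to equilibrium if and only if 1. every closed strongly connected component of $\mathcal T$ is aperiodic, and 2. every closed strongly connected component of $\mathcal G$ composed of oblivious agents only is aperiodic. The same equivalence holds if only initial states of the form $x_0=(b,b)$ with $b\in[0,1]^{nm}$ are considered (current beliefs equal to the stored initial beliefs). If there is no oblivious agent, the belief system always converges to equilibrium. -/

import Mathlib

open scoped Kronecker

namespace BeliefSystem

section Digraphs

variable {V : Type*}

/-- `Reaches D i j`: there is a directed path (possibly of length zero) from `i` to `j` in `D`. -/
def Reaches (D : Digraph V) (i j : V) : Prop :=
  Relation.ReflTransGen D.Adj i j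

/-- The first `l + 1` values `p 0, …, p l` of `p` form a cycle of `D` with `l ≥ 1` edges. As in the
theory of periods of directed graphs, vertices and edges may be repeated along a cycle. -/
def IsCycleOfLength (D : Digraph V) (l : ℕ) (p : ℕ → V) : Prop :=
  0 < l ∧ (∀ k < l, D.Adj (p k) (p (k + 1))) ∧ p 0 = p l

/-- The period of a directed graph: the greatest common divisor of the lengths of its cycles
(equal to `0` if there are none). -/
noncomputable def period (D : Digraph V) : ℕ :=
  Nat.setGcd {l | ∃ p : ℕ → V, IsCycleOfLength D l p}

/-- The subgraph of `D` induced on the set of nodes `S`. -/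
def inducedDigraph (D : Digraph V) (S : Set V) : Digraph S where
  Adj i j := D.Adj i j

/-- A strongly connected component: the set of all nodes that reach, and are reached from,
some fixed node. -/
def IsStronglyConnectedComponent (D : Digraph V) (S : Set V) : Prop :=
  ∃ i, S = {j | Reaches D i j ∧ Reaches D j i}

/-- A set of nodes is closed if no edge enters it from outside. -/
def IsClosedSet (D : Digraph V) (S : Set V) : Prop :=
  ∀ i ∈ S, ∀ j, D.Adj j i → j ∈ S

/-- A set of nodes is aperiodic if the subgraph that it induces has period one. -/
def IsAperiodicSet (D : Digraph V) (S : Set V) : Prop :=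
  period (inducedDigraph D S) = 1

/-- The directed graph compliant with a nonnegative weight matrix: since `M i j` is the weight that
`i` gives to `j`, a positive `M i j` is an edge from `j` to `i`. -/
def weightDigraph (M : Matrix V V ℝ) : Digraph V where
  Adj j i := 0 < M i j

end Digraphs

section Model

variable {V W : Type*}

/-- An agent is stubborn if its openness parameter is less than one. -/
def IsStubborn (lam : V → ℝ) (i : V) : Prop :=
  lam i < 1

/-- An agent is oblivious if it is maximally open and is not influenced, directly or through a chain
of other agents, by a stubborn agent. -/
def IsOblivious (A : Matrix V V ℝ) (lam : V → ℝ) (i : V) : Prop :=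
  lam i = 1 ∧ ∀ j, IsStubborn lam j → ¬ Reaches (weightDigraph A) j i

/-- The matrix `P` of the belief system. An index `Sum.inl (i, u)` is the current belief of the
agent `i` on the statement `u`, and `Sum.inr (i, u)` is its initial belief. -/
def systemMatrix [Fintype V] [DecidableEq V] [DecidableEq W]
    (A : Matrix V V ℝ) (C : Matrix W W ℝ) (lam : V → ℝ) :
    Matrix ((V × W) ⊕ (V × W)) ((V × W) ⊕ (V × W)) ℝ :=
  Matrix.fromBlocks
    ((Matrix.diagonal lam * A) ⊗ₖ C) ((1 - Matrix.diagonal lam) ⊗ₖ (1 : Matrix W W ℝ))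
    0 1

/-- The process `x (k + 1) = P x k` started from `x₀`. -/
def trajectory {ι : Type*} [Fintype ι] (P : Matrix ι ι ℝ) (x₀ : ι → ℝ) : ℕ → ι → ℝ
  | 0 => x₀
  | k + 1 => P.mulVec (trajectory P x₀ k)

/-- The process `x (k + 1) = P x k` started from `x₀` has a limit. -/
def ConvergesFrom {ι : Type*} [Fintype ι] (P : Matrix ι ι ℝ) (x₀ : ι → ℝ) : Prop :=
  ∃ x' : ι → ℝ, Filter.Tendsto (trajectory P x₀) Filter.atTop (nhds x')

/-- Convergence to equilibrium from every initial state in the unit cube. -/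
def ConvergesToEquilibrium [Fintype V] [DecidableEq V] [Fintype W] [DecidableEq W]
    (A : Matrix V V ℝ) (C : Matrix W W ℝ) (lam : V → ℝ) : Prop :=
  ∀ x₀ : (V × W) ⊕ (V × W) → ℝ, (∀ s, x₀ s ∈ Set.Icc (0 : ℝ) 1) →
    ConvergesFrom (systemMatrix A C lam) x₀

/-- Convergence to equilibrium from every initial state in the unit cube whose two halves (the
beliefs at time zero, and the stored initial beliefs) coincide. -/
def ConvergesFromInitialBeliefs [Fintype V] [DecidableEq V] [Fintype W] [DecidableEq W]
    (A : Matrix V V ℝ) (C : Matrix W W ℝ) (lam : V → ℝ) : Prop :=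
  ∀ b : V × W → ℝ, (∀ s, b s ∈ Set.Icc (0 : ℝ) 1) →
    ConvergesFrom (systemMatrix A C lam) (Sum.elim b b)

/-- Every closed strongly connected component of the graph of logic constraints is aperiodic. -/
def LogicCondition (C : Matrix W W ℝ) : Prop :=
  ∀ S : Set W, IsStronglyConnectedComponent (weightDigraph C) S →
    IsClosedSet (weightDigraph C) S → IsAperiodicSet (weightDigraph C) S

/-- Every closed strongly connected component of the social network that consists of oblivious
agents only is aperiodic. -/
def SocialCondition (A : Matrix V V ℝ) (lam : V → ℝ) : Prop :=
  ∀ S : Set V, IsStronglyConnectedComponent (weightDigraph A) S →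
    IsClosedSet (weightDigraph A) S → (∀ i ∈ S, IsOblivious A lam i) →
    IsAperiodicSet (weightDigraph A) S

end Model

end BeliefSystem

/-! Influence enters the oblivious agents only from oblivious agents, and there `lam = 1`, so their
beliefs evolve by `A ⊗ₖ C`, whose powers are `A ^ k ⊗ₖ C ^ k` (`trajectory_systemMatrix_inl`). Every
other agent is influenced by a stubborn one, hence by a constant stored belief.

A maximum principle (`tendsto_trajectory_of_reaches`) spreads convergence along edges: the
oscillation limsup − liminf is subharmonic, so its maximum over a closed set propagates backwards
along paths to a node where it is zero. Hence only oblivious beliefs matter, and each factor can be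
studied on its closed components, which reach every node.

On such a component, aperiodicity makes some power positive, which contracts the spread of values.
Any other period prevents consecutive powers from sharing a positive entry, so convergent entries
would tend to zero, against the row sums. For necessity, initial beliefs depending only on the
statement, or only on the agent, isolate one factor. -/

namespace BeliefSystem

open Filter Topology Matrix

/-! ### Stochastic trajectories and the maximum principle -/

section Trajectories

variable {V : Type*} [Fintype V]

lemma trajectory_eq_pow_mulVec [DecidableEq V] (P : Matrix V V ℝ) (x : V → ℝ) (k : ℕ) :
    trajectory P x k = (P ^ k) *ᵥ x := by
  induction k with
  | zero => simp [trajectory]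
  | succ k ih => rw [trajectory, ih, mulVec_mulVec, pow_succ']

lemma trajectory_succ_apply (P : Matrix V V ℝ) (x : V → ℝ) (k : ℕ) (i : V) :
    trajectory P x (k + 1) i = ∑ j, P i j * trajectory P x k j := rfl

lemma trajectory_neg (P : Matrix V V ℝ) (x : V → ℝ) (k : ℕ) :
    trajectory P (-x) k = -trajectory P x k := by
  induction k with
  | zero => rfl
  | succ k ih => rw [trajectory, trajectory, ih, mulVec_neg]

lemma trajectory_add (P : Matrix V V ℝ) (x : V → ℝ) (k l : ℕ) :
    trajectory P x (k + l) = trajectory P (trajectory P x k) l := by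
  induction l with
  | zero => rfl
  | succ l ih => rw [← add_assoc, trajectory, trajectory, ih]

lemma sum_mul_eq_sum_of_isClosedSet {P : Matrix V V ℝ} (hP : ∀ i j, 0 ≤ P i j) {S : Set V}
    [Fintype S] (hS : IsClosedSet (weightDigraph P) S) (f : V → ℝ) (i : S) :
    ∑ j : S, P i j * f j = ∑ j, P i j * f j := by
  refine Finset.sum_of_injOn ((↑) : S → V) Subtype.val_injective.injOn
    (fun _ _ => Finset.mem_coe.2 (Finset.mem_univ _)) (fun j _ hj => ?_) fun _ _ => rfl
  have : j ∉ S := by simpa using hj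
  have h0 : P i j = 0 := le_antisymm (not_lt.1 fun h => this (hS i i.2 j h)) (hP i j)
  rw [h0, zero_mul]

/-- The trajectory on a closed set of nodes is a trajectory of the restricted matrix. -/
lemma trajectory_submatrix {P : Matrix V V ℝ} (hP : ∀ i j, 0 ≤ P i j) {S : Set V} [Fintype S]
    (hS : IsClosedSet (weightDigraph P) S) (x : V → ℝ) (k : ℕ) (i : S) :
    trajectory (P.submatrix ((↑) : S → V) (↑)) (fun j => x j) k i = trajectory P x k i := by
  induction k generalizing i with
  | zero => rfl
  | succ k ih =>
    rw [trajectory_succ_apply, trajectory_succ_apply, ← sum_mul_eq_sum_of_isClosedSet hP hS]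
    simp only [ih, submatrix_apply]

lemma submatrix_mem_rowStochastic [DecidableEq V] {P : Matrix V V ℝ}
    (hP : P ∈ rowStochastic ℝ V) {S : Set V} [Fintype S] [DecidableEq S]
    (hS : IsClosedSet (weightDigraph P) S) :
    P.submatrix ((↑) : S → V) (↑) ∈ rowStochastic ℝ S := by
  refine mem_rowStochastic_iff_sum.2 ⟨fun i j => hP.1 i j, fun i => ?_⟩
  have := sum_mul_eq_sum_of_isClosedSet hP.1 hS (fun _ => 1) i
  simpa [sum_row_of_mem_rowStochastic hP] using this

lemma trajectory_le [DecidableEq V] {P : Matrix V V ℝ} (hP : P ∈ rowStochastic ℝ V) {x : V → ℝ}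
    {c : ℝ} (hx : ∀ i, x i ≤ c) (k : ℕ) (i : V) : trajectory P x k i ≤ c := by
  induction k generalizing i with
  | zero => exact hx i
  | succ k ih =>
    calc ∑ j, P i j * trajectory P x k j ≤ ∑ j, P i j * c :=
          Finset.sum_le_sum fun j _ => mul_le_mul_of_nonneg_left (ih j) (hP.1 i j)
      _ = c := by rw [← Finset.sum_mul, sum_row_of_mem_rowStochastic hP, one_mul]

lemma le_trajectory [DecidableEq V] {P : Matrix V V ℝ} (hP : P ∈ rowStochastic ℝ V) {x : V → ℝ}
    {c : ℝ} (hx : ∀ i, c ≤ x i) (k : ℕ) (i : V) : c ≤ trajectory P x k i := by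
  have := trajectory_le hP (x := -x) (c := -c) (fun i => neg_le_neg (hx i)) k i
  rw [trajectory_neg] at this
  exact neg_le_neg_iff.1 this

lemma isBoundedUnder_le_trajectory [DecidableEq V] {P : Matrix V V ℝ}
    (hP : P ∈ rowStochastic ℝ V) (x : V → ℝ) (i : V) :
    IsBoundedUnder (· ≤ ·) atTop fun k => trajectory P x k i := by
  obtain ⟨c, hc⟩ := (Set.finite_range x).bddAbove
  exact isBoundedUnder_of ⟨c, fun k => trajectory_le hP (fun j => hc ⟨j, rfl⟩) k i⟩

lemma isBoundedUnder_ge_trajectory [DecidableEq V] {P : Matrix V V ℝ}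
    (hP : P ∈ rowStochastic ℝ V) (x : V → ℝ) (i : V) :
    IsBoundedUnder (· ≥ ·) atTop fun k => trajectory P x k i := by
  obtain ⟨c, hc⟩ := (Set.finite_range x).bddBelow
  exact isBoundedUnder_of ⟨c, fun k => le_trajectory hP (fun j => hc ⟨j, rfl⟩) k i⟩

/-- The upper limits of the coordinates of a trajectory are subharmonic. -/
lemma limsup_trajectory_le [DecidableEq V] {P : Matrix V V ℝ} (hP : P ∈ rowStochastic ℝ V)
    (x : V → ℝ) (i : V) :
    limsup (fun k => trajectory P x k i) atTop ≤
      ∑ j, P i j * limsup (fun k => trajectory P x k j) atTop := by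
  refine le_of_forall_pos_le_add fun ε hε => ?_
  have hev : ∀ᶠ k in atTop, ∀ j, trajectory P x k j <
      limsup (fun k => trajectory P x k j) atTop + ε :=
    eventually_all.2 fun j => eventually_lt_of_limsup_lt (lt_add_of_pos_right _ hε)
      (isBoundedUnder_le_trajectory hP x j)
  obtain ⟨N, hN⟩ := eventually_atTop.1 hev
  refine limsup_le_of_le (isBoundedUnder_ge_trajectory hP x i).isCoboundedUnder_le
    (eventually_atTop.2 ⟨N + 1, fun k hk => ?_⟩)
  obtain ⟨k, rfl⟩ : ∃ l, k = l + 1 := ⟨k - 1, by omega⟩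
  calc trajectory P x (k + 1) i
      ≤ ∑ j, P i j * (limsup (fun k => trajectory P x k j) atTop + ε) :=
        Finset.sum_le_sum fun j _ =>
          mul_le_mul_of_nonneg_left (hN k (by omega) j).le (hP.1 i j)
    _ = _ := by
        simp only [mul_add, Finset.sum_add_distrib, ← Finset.sum_mul,
          sum_row_of_mem_rowStochastic hP, one_mul]

/-- On a closed set of nodes, each of which is reached from a node where the trajectory has a
limit, the trajectory has a limit. -/
lemma tendsto_trajectory_of_reaches [DecidableEq V] {P : Matrix V V ℝ}
    (hP : P ∈ rowStochastic ℝ V) (x : V → ℝ) {O : Set V}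
    (hO : IsClosedSet (weightDigraph P) O)
    (h : ∀ i ∈ O, ∃ j, Reaches (weightDigraph P) j i ∧
      ∃ l, Tendsto (fun k => trajectory P x k j) atTop (𝓝 l)) :
    ∀ i ∈ O, ∃ l, Tendsto (fun k => trajectory P x k i) atTop (𝓝 l) := by
  -- Since limsup(−x) = −liminf x, this is the oscillation limsup − liminf; it vanishes exactly
  -- where the trajectory converges.
  set D : V → ℝ := fun i => limsup (fun k => trajectory P x k i) atTop +
    limsup (fun k => trajectory P (-x) k i) atTop with hD
  have hsub : ∀ i, D i ≤ ∑ j, P i j * D j := fun i => by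
    simp only [hD, mul_add, Finset.sum_add_distrib]
    exact add_le_add (limsup_trajectory_le hP x i) (limsup_trajectory_le hP (-x) i)
  suffices hle : ∀ i ∈ O, D i ≤ 0 by
    intro i hi
    have hi0 : limsup (fun k => trajectory P x k i) atTop +
      limsup (fun k => trajectory P (-x) k i) atTop ≤ 0 := hle i hi
    refine ⟨limsup (fun k => trajectory P x k i) atTop, tendsto_order.2 ⟨fun b hb => ?_,
      fun b hb => eventually_lt_of_limsup_lt hb (isBoundedUnder_le_trajectory hP x i)⟩⟩
    refine (eventually_lt_of_limsup_lt (b := -b) (by linarith)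
      (isBoundedUnder_le_trajectory hP (-x) i)).mono fun k hk => ?_
    rw [trajectory_neg] at hk
    exact neg_lt_neg_iff.1 hk
  intro i hi
  obtain ⟨m, hmO, hm⟩ := O.toFinite.exists_maximalFor D O ⟨i, hi⟩
  have hmax : ∀ j ∈ O, D j ≤ D m := fun j hj => (le_total (D j) (D m)).elim id (hm hj)
  obtain ⟨j, hjm, l, hl⟩ := h m hmO
  -- A weighted average of values at most `D m` equals `D m` only if every positively weighted value
  -- does, so maximality passes to predecessors.
  have key : j ∈ O ∧ D j = D m := by
    clear hl
    induction hjm using Relation.ReflTransGen.head_induction_on with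
    | refl => exact ⟨hmO, rfl⟩
    | @head a c hadj _ ih =>
      have ha : a ∈ O := hO c ih.1 a hadj
      refine ⟨ha, (hmax a ha).antisymm (not_lt.1 fun hlt => ?_)⟩
      refine lt_irrefl (D m) ?_
      calc D m = D c := ih.2.symm
        _ ≤ ∑ j, P c j * D j := hsub c
        _ < ∑ j, P c j * D m := by
          refine Finset.sum_lt_sum (fun j _ => ?_)
            ⟨a, Finset.mem_univ a, mul_lt_mul_of_pos_left hlt hadj⟩
          rcases (hP.1 c j).eq_or_lt with h0 | h0
          · rw [← h0, zero_mul, zero_mul]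
          · exact mul_le_mul_of_nonneg_left (hmax j (hO c ih.1 j h0)) h0.le
        _ = D m := by rw [← Finset.sum_mul, sum_row_of_mem_rowStochastic hP, one_mul]
  have hj0 : D j = 0 := by
    simp only [hD, trajectory_neg, Pi.neg_apply, hl.limsup_eq, hl.neg.limsup_eq, add_neg_cancel]
  exact (hmax i hi).trans (key.2 ▸ hj0).le

end Trajectories

/-! ### Closed components of finite digraphs -/

section Graphs

variable {V : Type*}

lemma Reaches.mem_of_isClosedSet {D : Digraph V} {S : Set V} (hS : IsClosedSet D S) {i j : V}
    (h : Reaches D i j) (hj : j ∈ S) : i ∈ S := by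
  induction h using Relation.ReflTransGen.head_induction_on with
  | refl => exact hj
  | head hadj _ ih => exact hS _ ih _ hadj

lemma reaches_inducedDigraph {D : Digraph V} {S : Set V} (hS : IsStronglyConnectedComponent D S)
    (hc : IsClosedSet D S) (i j : S) : Reaches (inducedDigraph D S) i j := by
  obtain ⟨s, rfl⟩ := hS
  have aux : ∀ {a b : V}, Reaches D a b → ∀ hb : b ∈ _, ∃ ha : a ∈ _,
      Reaches (inducedDigraph D {j | Reaches D s j ∧ Reaches D j s}) ⟨a, ha⟩ ⟨b, hb⟩ := by
    intro a b h hb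
    induction h using Relation.ReflTransGen.head_induction_on with
    | refl => exact ⟨hb, Relation.ReflTransGen.refl⟩
    | head hadj _ ih =>
      obtain ⟨ha, h⟩ := ih
      have ha' := hc _ ha _ hadj
      exact ⟨ha', Relation.ReflTransGen.head
        (show (inducedDigraph D _).Adj ⟨_, ha'⟩ ⟨_, ha⟩ from hadj) h⟩
  exact (aux (i.2.2.trans j.2.1) j.2).2

/-- Among the ancestors of `i`, one with a minimal set of ancestors is reached from each of its own
ancestors, so its component is closed. -/
lemma exists_closed_component_reaches [Finite V] (D : Digraph V) (i : V) :
    ∃ S, IsStronglyConnectedComponent D S ∧ IsClosedSet D S ∧ ∃ j ∈ S, Reaches D j i := by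
  obtain ⟨j, hj, hmin⟩ := {j | Reaches D j i}.toFinite.exists_minimalFor
    (fun j => {k | Reaches D k j}) _ ⟨i, Relation.ReflTransGen.refl⟩
  refine ⟨{k | Reaches D j k ∧ Reaches D k j}, ⟨j, rfl⟩, fun k hk l hl => ?_, j,
    ⟨Relation.ReflTransGen.refl, Relation.ReflTransGen.refl⟩, hj⟩
  have hlj : Reaches D l j := Relation.ReflTransGen.head hl hk.2
  exact ⟨hmin (j := l) (hlj.trans hj) (fun m hm => hm.trans hlj) Relation.ReflTransGen.refl, hlj⟩

lemma nonempty_of_isStronglyConnectedComponent {D : Digraph V} {S : Set V}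
    (hS : IsStronglyConnectedComponent D S) : S.Nonempty := by
  obtain ⟨i, rfl⟩ := hS
  exact ⟨i, Relation.ReflTransGen.refl, Relation.ReflTransGen.refl⟩

end Graphs

/-! ### Positive powers, periods and convergence -/

section Walks

variable {V : Type*} [Fintype V] [DecidableEq V] {P : Matrix V V ℝ}

/-- Edges point from column to row, so the walk runs from `j` to `i`. -/
lemma pow_apply_pos_iff (hP : P ∈ rowStochastic ℝ V) {k : ℕ} {i j : V} :
    0 < (P ^ k) i j ↔ ∃ p : ℕ → V,
      p 0 = j ∧ p k = i ∧ ∀ m < k, (weightDigraph P).Adj (p m) (p (m + 1)) := by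
  induction k generalizing i with
  | zero =>
    by_cases h : i = j
    · subst h; simpa using ⟨fun _ => i, rfl⟩
    · simp only [pow_zero, one_apply_ne h, lt_irrefl, false_iff]
      rintro ⟨p, h0, h1, -⟩
      exact h (h1.symm.trans h0)
  | succ k ih =>
    rw [pow_succ', mul_apply, Finset.sum_pos_iff_of_nonneg fun v _ =>
      mul_nonneg (hP.1 _ _) ((pow_mem hP k).1 _ _)]
    constructor
    · rintro ⟨v, -, hv⟩
      have h1 := pos_of_mul_pos_left hv ((pow_mem hP k).1 _ _)
      have h2 := pos_of_mul_pos_right hv (hP.1 _ _)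
      obtain ⟨p, h0, hk, hp⟩ := ih.1 h2
      refine ⟨fun m => if m = k + 1 then i else p m, by simpa using h0, by simp, fun m hm => ?_⟩
      rcases Nat.lt_succ_iff_lt_or_eq.1 hm with hm | rfl
      · simpa [show m ≠ k + 1 by omega, show m ≠ k by omega] using hp m hm
      · simpa [hk, weightDigraph] using h1
    · rintro ⟨p, h0, hk, hp⟩
      refine ⟨p k, Finset.mem_univ _, mul_pos (hk ▸ hp k (by omega)) (ih.2 ?_)⟩
      exact ⟨p, h0, rfl, fun m hm => hp m (by omega)⟩

lemma pow_add_apply_pos (hP : P ∈ rowStochastic ℝ V) {k l : ℕ} {i j v : V}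
    (h1 : 0 < (P ^ k) i v) (h2 : 0 < (P ^ l) v j) : 0 < (P ^ (k + l)) i j := by
  rw [pow_add, mul_apply]
  exact Finset.sum_pos' (fun v _ => mul_nonneg ((pow_mem hP k).1 _ _) ((pow_mem hP l).1 _ _))
    ⟨v, Finset.mem_univ _, mul_pos h1 h2⟩

lemma exists_pow_apply_pos_of_reaches (hP : P ∈ rowStochastic ℝ V) {i j : V}
    (h : Reaches (weightDigraph P) j i) : ∃ k, 0 < (P ^ k) i j := by
  induction h with
  | refl => exact ⟨0, by simp⟩
  | tail _ hadj ih =>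
    obtain ⟨k, hk⟩ := ih
    exact ⟨1 + k, pow_add_apply_pos hP (by rwa [pow_one]) hk⟩

lemma period_dvd_of_pow_apply_self_pos (hP : P ∈ rowStochastic ℝ V) {k : ℕ} {i : V}
    (h : 0 < (P ^ k) i i) : period (weightDigraph P) ∣ k := by
  rcases Nat.eq_zero_or_pos k with rfl | hk
  · exact dvd_zero _
  · obtain ⟨p, h0, h1, hp⟩ := (pow_apply_pos_iff hP).1 h
    exact Nat.setGcd_dvd_of_mem ⟨p, hk, hp, h0.trans h1.symm⟩

lemma dvd_period (hP : P ∈ rowStochastic ℝ V) {d : ℕ}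
    (h : ∀ k i, 0 < (P ^ k) i i → d ∣ k) : d ∣ period (weightDigraph P) := by
  refine Nat.dvd_setGcd_iff.2 ?_
  rintro k ⟨p, -, hp, hk⟩
  exact h k (p 0) ((pow_apply_pos_iff hP).2 ⟨p, rfl, hk.symm, hp⟩)

/-- The return times to `i` form a numerical semigroup of gcd one, which contains all large
integers; a fixed walk from `j` to `i` then gives the other entries. -/
lemma eventually_pow_apply_pos (hP : P ∈ rowStochastic ℝ V)
    (hr : ∀ i j, Reaches (weightDigraph P) i j) (hp : period (weightDigraph P) = 1) :
    ∀ᶠ k in atTop, ∀ i j, 0 < (P ^ k) i j := by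
  refine eventually_all.2 fun i => eventually_all.2 fun j => ?_
  let R : AddSubmonoid ℕ :=
    { carrier := {l | 0 < (P ^ l) i i}
      zero_mem' := by simp
      add_mem' := fun h1 h2 => pow_add_apply_pos hP h1 h2 }
  have hR : Nat.setGcd (R : Set ℕ) = 1 := by
    -- A round trip from `i` through `v`, with and without a cycle of length `k` at `v`, gives two
    -- return times differing by `k`.
    refine Nat.dvd_one.1 (hp ▸ dvd_period hP fun k v hk => ?_)
    obtain ⟨a, ha⟩ := exists_pow_apply_pos_of_reaches hP (hr v i)
    obtain ⟨b, hb⟩ := exists_pow_apply_pos_of_reaches hP (hr i v)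
    have h1 := Nat.setGcd_dvd_of_mem (s := R) (pow_add_apply_pos hP ha hb)
    have h2 := Nat.setGcd_dvd_of_mem (s := R)
      (pow_add_apply_pos hP ha (pow_add_apply_pos hP hk hb))
    rw [← add_assoc, add_right_comm] at h2
    exact (Nat.dvd_add_right h1).1 h2
  obtain ⟨N, hN⟩ := Nat.exists_mem_closure_of_ge (R : Set ℕ)
  rw [AddSubmonoid.closure_eq] at hN
  obtain ⟨a, ha⟩ := exists_pow_apply_pos_of_reaches hP (hr j i)
  refine eventually_atTop.2 ⟨N + a, fun k hk => ?_⟩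
  have := pow_add_apply_pos hP (hN (k - a) (by omega) (hR ▸ one_dvd _)) ha
  rwa [Nat.sub_add_cancel (by omega)] at this

/-- If the directed graph of `P` is strongly connected and aperiodic, all trajectories converge. -/
lemma convergesFrom_of_period_eq_one (hP : P ∈ rowStochastic ℝ V)
    (hr : ∀ i j, Reaches (weightDigraph P) i j) (hp : period (weightDigraph P) = 1)
    (x : V → ℝ) : ConvergesFrom P x := by
  cases isEmpty_or_nonempty V
  · exact ⟨x, tendsto_pi_nhds.2 fun i => isEmptyElim i⟩
  obtain ⟨N, hN⟩ := (eventually_pow_apply_pos hP hr hp).exists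
  obtain ⟨⟨i₀, j₀⟩, hδ⟩ := Finite.exists_min fun q : V × V => (P ^ N) q.1 q.2
  set δ := (P ^ N) i₀ j₀
  set M : ℕ → ℝ := fun k => Finset.univ.sup' Finset.univ_nonempty (trajectory P x k)
  set m : ℕ → ℝ := fun k => Finset.univ.inf' Finset.univ_nonempty (trajectory P x k)
  have hM : ∀ k i, trajectory P x k i ≤ M k := fun k i => Finset.le_sup' _ (Finset.mem_univ i)
  have hm : ∀ k i, m k ≤ trajectory P x k i := fun k i => Finset.inf'_le _ (Finset.mem_univ i)
  have hMa : Antitone M := antitone_nat_of_succ_le fun k => Finset.sup'_le _ _ fun i _ => by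
    rw [trajectory_add]
    exact trajectory_le hP (hM k) 1 i
  have hmm : Monotone m := monotone_nat_of_le_succ fun k => Finset.le_inf' _ _ fun i _ => by
    rw [trajectory_add]
    exact le_trajectory hP (hm k) 1 i
  obtain ⟨i₁⟩ := ‹Nonempty V›
  have hmM : ∀ k, m k ≤ M k := fun k => (hm k i₁).trans (hM k i₁)
  have hMl : Tendsto M atTop (𝓝 (⨅ k, M k)) := tendsto_atTop_ciInf hMa
    ⟨m 0, by rintro _ ⟨k, rfl⟩; exact (hmm (Nat.zero_le k)).trans (hmM k)⟩
  have hml : Tendsto m atTop (𝓝 (⨆ k, m k)) := tendsto_atTop_ciSup hmm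
    ⟨M 0, by rintro _ ⟨k, rfl⟩; exact (hmM k).trans (hMa (Nat.zero_le k))⟩
  -- After `N` steps each coordinate gives weight at least `δ`, the least entry of `P ^ N`, to a
  -- node where the minimum is attained.
  have hcontr : ∀ k, M (k + N) ≤ M k - δ * (M k - m k) := fun k =>
    Finset.sup'_le _ _ fun i _ => by
      obtain ⟨j, -, hj⟩ := Finset.exists_mem_eq_inf' Finset.univ_nonempty (trajectory P x k)
      rw [trajectory_add, trajectory_eq_pow_mulVec]
      have h1 : ∑ v, (P ^ N) i v * (M k - trajectory P x k v) =
          M k - ((P ^ N) *ᵥ trajectory P x k) i := by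
        simp only [mul_sub, Finset.sum_sub_distrib, ← Finset.sum_mul,
          sum_row_of_mem_rowStochastic (pow_mem hP N), one_mul]
        rfl
      have h2 : (P ^ N) i j * (M k - trajectory P x k j) ≤
          ∑ v, (P ^ N) i v * (M k - trajectory P x k v) :=
        Finset.single_le_sum (f := fun v => (P ^ N) i v * (M k - trajectory P x k v))
          (fun v _ => mul_nonneg ((pow_mem hP N).1 _ _) (sub_nonneg.2 (hM k v)))
          (Finset.mem_univ j)
      have h3 : δ * (M k - m k) ≤ (P ^ N) i j * (M k - trajectory P x k j) := by
        rw [← hj]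
        exact mul_le_mul_of_nonneg_right (hδ (i, j)) (sub_nonneg.2 (hmM k))
      linarith
  have hlim := le_of_tendsto_of_tendsto' ((tendsto_add_atTop_iff_nat N).2 hMl)
    (hMl.sub ((hMl.sub hml).const_mul δ)) hcontr
  have hge : (⨆ k, m k) ≤ ⨅ k, M k := le_of_tendsto_of_tendsto' hml hMl hmM
  have heq : (⨆ k, m k) = ⨅ k, M k := by
    have : 0 < δ := hN i₀ j₀
    nlinarith
  exact ⟨fun _ => ⨅ k, M k, tendsto_pi_nhds.2 fun i => tendsto_of_tendsto_of_tendsto_of_le_of_le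
    (heq ▸ hml) hMl (fun k => hm k i) fun k => hM k i⟩

/-- If the directed graph of `P` is strongly connected and all trajectories starting in the unit
cube converge, it is aperiodic. -/
lemma period_eq_one_of_convergesFrom [Nonempty V] (hP : P ∈ rowStochastic ℝ V)
    (hr : ∀ i j, Reaches (weightDigraph P) i j)
    (h : ∀ x : V → ℝ, (∀ i, x i ∈ Set.Icc (0 : ℝ) 1) → ConvergesFrom P x) :
    period (weightDigraph P) = 1 := by
  by_contra hne
  obtain ⟨i⟩ := ‹Nonempty V›
  -- Otherwise a single return walk closes both walks into cycles of consecutive lengths, and the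
  -- period divides one.
  have hzero : ∀ k j, (P ^ k) i j * (P ^ (k + 1)) i j = 0 := by
    intro k j
    by_contra h0
    have h1 : 0 < (P ^ k) i j := ((pow_mem hP k).1 i j).lt_of_ne' (left_ne_zero_of_mul h0)
    have h2 : 0 < (P ^ (k + 1)) i j :=
      ((pow_mem hP (k + 1)).1 i j).lt_of_ne' (right_ne_zero_of_mul h0)
    obtain ⟨a, ha⟩ := exists_pow_apply_pos_of_reaches hP (hr i j)
    have d1 := period_dvd_of_pow_apply_self_pos hP (pow_add_apply_pos hP ha h1)
    have d2 := period_dvd_of_pow_apply_self_pos hP (pow_add_apply_pos hP ha h2)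
    rw [← add_assoc] at d2
    exact hne (Nat.dvd_one.1 ((Nat.dvd_add_right d1).1 d2))
  have hlim : ∀ j, Tendsto (fun k => (P ^ k) i j) atTop (𝓝 0) := by
    intro j
    obtain ⟨l, hl⟩ := h (Pi.single j 1) fun v => by
      by_cases hv : v = j
      · subst hv; simp
      · simp [hv]
    have hl : Tendsto (fun k => (P ^ k) i j) atTop (𝓝 (l i)) := by
      simpa [trajectory_eq_pow_mulVec] using tendsto_pi_nhds.1 hl i
    -- Consecutive entries have product zero and a common limit, so that limit squares to zero.
    have hll := hl.mul (hl.comp (tendsto_add_atTop_nat 1))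
    have h0 : l i * l i = 0 := tendsto_nhds_unique hll
      (tendsto_const_nhds.congr fun k => (hzero k j).symm)
    rwa [mul_self_eq_zero.1 h0] at hl
  have hsum := tendsto_finsetSum Finset.univ fun j _ => hlim j
  simp only [sum_row_of_mem_rowStochastic (pow_mem hP _), Finset.sum_const_zero] at hsum
  exact one_ne_zero (tendsto_nhds_unique tendsto_const_nhds hsum)

end Walks

/-! ### From closed components to closed sets -/

section Components

variable {V : Type*} [Fintype V] [DecidableEq V] {P : Matrix V V ℝ}

lemma isAperiodicSet_of_tendsto_trajectory (hP : P ∈ rowStochastic ℝ V) {S : Set V}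
    (hS : IsStronglyConnectedComponent (weightDigraph P) S)
    (hc : IsClosedSet (weightDigraph P) S)
    (h : ∀ x : V → ℝ, (∀ i, x i ∈ Set.Icc (0 : ℝ) 1) →
      ∀ i ∈ S, ∃ l, Tendsto (fun k => trajectory P x k i) atTop (𝓝 l)) :
    IsAperiodicSet (weightDigraph P) S := by
  classical
  have := Fintype.ofFinite S
  have := (nonempty_of_isStronglyConnectedComponent hS).to_subtype
  refine period_eq_one_of_convergesFrom (submatrix_mem_rowStochastic hP hc)
    (reaches_inducedDigraph hS hc) fun y hy => ?_
  let x : V → ℝ := fun j => if hj : j ∈ S then y ⟨j, hj⟩ else 0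
  have hx : (fun j : S => x j) = y := funext fun j => by simp [x]
  have hlim := h x fun i => by
    by_cases hi : i ∈ S
    · simpa [x, hi] using hy ⟨i, hi⟩
    · simp [x, hi]
  choose l hl using hlim
  refine ⟨fun i => l i i.2, tendsto_pi_nhds.2 fun i => ?_⟩
  rw [← hx]
  exact (hl i i.2).congr fun k => (trajectory_submatrix hP.1 hc x k i).symm

/-- If all closed strongly connected components inside a closed set are aperiodic, all trajectories
converge on this closed set. -/
lemma tendsto_trajectory_of_isAperiodicSet (hP : P ∈ rowStochastic ℝ V) {O : Set V}
    (hO : IsClosedSet (weightDigraph P) O)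
    (h : ∀ S : Set V, IsStronglyConnectedComponent (weightDigraph P) S →
      IsClosedSet (weightDigraph P) S → S ⊆ O → IsAperiodicSet (weightDigraph P) S)
    (x : V → ℝ) : ∀ i ∈ O, ∃ l, Tendsto (fun k => trajectory P x k i) atTop (𝓝 l) := by
  classical
  refine tendsto_trajectory_of_reaches hP x hO fun i hi => ?_
  obtain ⟨S, hS, hc, j, hj, hji⟩ := exists_closed_component_reaches (weightDigraph P) i
  have hSO : S ⊆ O := by
    have hjO := hji.mem_of_isClosedSet hO hi
    obtain ⟨s, rfl⟩ := hS
    exact fun v hv => Reaches.mem_of_isClosedSet hO (hv.2.trans hj.1) hjO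
  have := Fintype.ofFinite S
  obtain ⟨l, hl⟩ := convergesFrom_of_period_eq_one (submatrix_mem_rowStochastic hP hc)
    (reaches_inducedDigraph hS hc) (h S hS hc hSO) fun j => x j
  refine ⟨j, hji, l ⟨j, hj⟩, ?_⟩
  simpa only [trajectory_submatrix hP.1 hc] using tendsto_pi_nhds.1 hl ⟨j, hj⟩

end Components

/-! ### The belief system matrix and oblivious agents -/

section Entries

variable {V W : Type*} [Fintype V] [DecidableEq V] [DecidableEq W]
  {A : Matrix V V ℝ} {C : Matrix W W ℝ} {lam : V → ℝ}

lemma systemMatrix_inl_inl (i j : V) (u v : W) :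
    systemMatrix A C lam (Sum.inl (i, u)) (Sum.inl (j, v)) = lam i * A i j * C u v := by
  simp [systemMatrix]

lemma systemMatrix_inl_inr (i : V) (u : W) (s : V × W) :
    systemMatrix A C lam (Sum.inl (i, u)) (Sum.inr s) = if (i, u) = s then 1 - lam i else 0 := by
  obtain ⟨j, v⟩ := s
  by_cases hi : i = j
  · subst hi
    by_cases hu : u = v <;> simp [systemMatrix, hu]
  · simp [systemMatrix, hi]

end Entries

lemma isClosedSet_isOblivious {V : Type*} {A : Matrix V V ℝ} {lam : V → ℝ}
    (hlam : ∀ i, lam i ∈ Set.Icc (0 : ℝ) 1) :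
    IsClosedSet (weightDigraph A) {i | IsOblivious A lam i} := by
  intro i hi j hji
  have hr : Reaches (weightDigraph A) j i := Relation.ReflTransGen.single hji
  have hstub : ∀ s, IsStubborn lam s → ¬ Reaches (weightDigraph A) s j :=
    fun s hs hsj => hi.2 s hs (hsj.trans hr)
  exact ⟨le_antisymm (hlam j).2 (not_lt.1 fun h => hstub j h Relation.ReflTransGen.refl), hstub⟩

/-! ### Convergence of the belief system -/

section System

variable {V W : Type*} [Fintype V] [DecidableEq V] [Fintype W] [DecidableEq W]
  {A : Matrix V V ℝ} {C : Matrix W W ℝ} {lam : V → ℝ}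

lemma kronecker_pow (A : Matrix V V ℝ) (C : Matrix W W ℝ) (k : ℕ) :
    (A ⊗ₖ C) ^ k = (A ^ k) ⊗ₖ (C ^ k) := by
  induction k with
  | zero => simp
  | succ k ih => rw [pow_succ, ih, pow_succ, pow_succ, mul_kronecker_mul]

lemma systemMatrix_mem_rowStochastic (hA : A ∈ rowStochastic ℝ V) (hC : C ∈ rowStochastic ℝ W)
    (hlam : ∀ i, lam i ∈ Set.Icc (0 : ℝ) 1) :
    systemMatrix A C lam ∈ rowStochastic ℝ ((V × W) ⊕ (V × W)) := by
  refine mem_rowStochastic_iff_sum.2 ⟨?_, ?_⟩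
  · rintro (⟨i, u⟩ | s) (⟨j, v⟩ | t)
    · rw [systemMatrix_inl_inl]
      exact mul_nonneg (mul_nonneg (hlam i).1 (hA.1 _ _)) (hC.1 _ _)
    · rw [systemMatrix_inl_inr]
      split_ifs
      exacts [sub_nonneg.2 (hlam i).2, le_rfl]
    · exact le_rfl
    · simp only [systemMatrix, fromBlocks_apply₂₂, one_apply]
      split_ifs <;> norm_num
  · rintro (⟨i, u⟩ | s)
    · simp only [Fintype.sum_sum_type, Fintype.sum_prod_type, systemMatrix_inl_inl, ← Finset.mul_sum,
        sum_row_of_mem_rowStochastic hC, sum_row_of_mem_rowStochastic hA, mul_one]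
      simp only [← Fintype.sum_prod_type', systemMatrix_inl_inr]
      simp
    · simp [systemMatrix, one_apply]

lemma trajectory_systemMatrix_inr (x : (V × W) ⊕ (V × W) → ℝ) (k : ℕ) (s : V × W) :
    trajectory (systemMatrix A C lam) x k (Sum.inr s) = x (Sum.inr s) := by
  induction k with
  | zero => rfl
  | succ k ih =>
    rw [trajectory_succ_apply, ← ih]
    simp [systemMatrix, one_apply]

/-- Oblivious agents follow the DeGroot dynamics. -/
lemma trajectory_systemMatrix_inl (hA : A ∈ rowStochastic ℝ V)
    (hlam : ∀ i, lam i ∈ Set.Icc (0 : ℝ) 1) (x : (V × W) ⊕ (V × W) → ℝ) (k : ℕ)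
    {i : V} (hi : IsOblivious A lam i) (u : W) :
    trajectory (systemMatrix A C lam) x k (Sum.inl (i, u)) =
      ∑ j, ∑ v, (A ^ k) i j * (C ^ k) u v * x (Sum.inl (j, v)) := by
  trans trajectory (A ⊗ₖ C) (fun s => x (Sum.inl s)) k (i, u)
  · induction k generalizing i u with
    | zero => rfl
    | succ k ih =>
      simp only [trajectory_succ_apply, Fintype.sum_sum_type, systemMatrix_inl_inr, hi.1, sub_self,
        ite_self, zero_mul, Finset.sum_const_zero, add_zero]
      refine Finset.sum_congr rfl fun ⟨j, v⟩ _ => ?_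
      rw [systemMatrix_inl_inl, hi.1, one_mul, kroneckerMap_apply]
      -- Agents of zero weight do not contribute; those of positive weight are again oblivious, so
      -- the induction hypothesis applies.
      rcases (hA.1 i j).eq_or_lt with h0 | h0
      · simp [← h0]
      · rw [ih (isClosedSet_isOblivious hlam i hi j h0)]
  · rw [trajectory_eq_pow_mulVec, kronecker_pow]
    simp [mulVec, dotProduct, Fintype.sum_prod_type]

/-- A path is followed back from `i` to the last stubborn agent on it. Past that agent `lam = 1`,
and each step lifts because every row of `C` has a positive entry, possibly at another statement. -/
lemma exists_reaches_systemMatrix_of_isStubborn (hC : C ∈ rowStochastic ℝ W)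
    (hlam : ∀ i, lam i ∈ Set.Icc (0 : ℝ) 1) {i j : V} (hj : IsStubborn lam j)
    (h : Reaches (weightDigraph A) j i) (u : W) :
    ∃ s, Reaches (weightDigraph (systemMatrix A C lam)) (Sum.inr s) (Sum.inl (i, u)) := by
  have hstub : ∀ {c : V} (w : W), IsStubborn lam c →
      Reaches (weightDigraph (systemMatrix A C lam)) (Sum.inr (c, w)) (Sum.inl (c, w)) :=
    fun {c} w hc => Relation.ReflTransGen.single <| by
      change 0 < systemMatrix A C lam (Sum.inl (c, w)) (Sum.inr (c, w))
      rw [systemMatrix_inl_inr, if_pos rfl]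
      exact sub_pos.2 hc
  induction h generalizing u with
  | refl => exact ⟨_, hstub u hj⟩
  | @tail b c _ hadj ih =>
    rcases (hlam c).2.lt_or_eq with hc | hc
    · exact ⟨_, hstub u hc⟩
    · obtain ⟨v, -, hv⟩ : ∃ v ∈ Finset.univ, 0 < C u v := by
        refine Finset.exists_lt_of_sum_lt ?_
        simp [sum_row_of_mem_rowStochastic hC]
      obtain ⟨s, hs⟩ := ih v
      refine ⟨s, hs.tail ?_⟩
      change 0 < systemMatrix A C lam (Sum.inl (c, u)) (Sum.inl (b, v))
      rw [systemMatrix_inl_inl, hc, one_mul]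
      exact mul_pos hadj hv

/-- The belief system converges as soon as the beliefs of the oblivious agents do. -/
lemma convergesToEquilibrium_of_isOblivious (hA : A ∈ rowStochastic ℝ V)
    (hC : C ∈ rowStochastic ℝ W) (hlam : ∀ i, lam i ∈ Set.Icc (0 : ℝ) 1)
    (h : ∀ (x : (V × W) ⊕ (V × W) → ℝ) (i : V) (u : W), IsOblivious A lam i →
      ∃ l, Tendsto (fun k => trajectory (systemMatrix A C lam) x k (Sum.inl (i, u)))
        atTop (𝓝 l)) :
    ConvergesToEquilibrium A C lam := by
  intro x _
  have hinr : ∀ s, ∃ l, Tendsto (fun k => trajectory (systemMatrix A C lam) x k (Sum.inr s))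
      atTop (𝓝 l) := fun s =>
    ⟨x (Sum.inr s), tendsto_const_nhds.congr fun k => (trajectory_systemMatrix_inr x k s).symm⟩
  have hlim := tendsto_trajectory_of_reaches (systemMatrix_mem_rowStochastic hA hC hlam) x
    (O := Set.univ) (fun _ _ _ _ => Set.mem_univ _) <| by
      rintro (⟨i, u⟩ | s) -
      · by_cases hi : IsOblivious A lam i
        · exact ⟨_, Relation.ReflTransGen.refl, h x i u hi⟩
        · obtain ⟨j, hj, hji⟩ : ∃ j, IsStubborn lam j ∧ Reaches (weightDigraph A) j i := by
            by_contra! hcon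
            refine hi ⟨le_antisymm (hlam i).2 (not_lt.1 fun hlt => ?_), hcon⟩
            exact hcon i hlt Relation.ReflTransGen.refl
          obtain ⟨s, hs⟩ := exists_reaches_systemMatrix_of_isStubborn hC hlam hj hji u
          exact ⟨_, hs, hinr s⟩
      · exact ⟨_, Relation.ReflTransGen.refl, hinr s⟩
  choose l hl using hlim
  exact ⟨fun s => l s (Set.mem_univ s), tendsto_pi_nhds.2 fun s => hl s (Set.mem_univ s)⟩

/-- The entries of `A ^ k` and `C ^ k` converge separately, so the periods of the product graph
never enter. -/
lemma convergesToEquilibrium_of_conditions (hA : A ∈ rowStochastic ℝ V)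
    (hC : C ∈ rowStochastic ℝ W) (hlam : ∀ i, lam i ∈ Set.Icc (0 : ℝ) 1)
    (hT : LogicCondition C) (hG : SocialCondition A lam) : ConvergesToEquilibrium A C lam := by
  refine convergesToEquilibrium_of_isOblivious hA hC hlam fun x i u hi => ?_
  have hAlim : ∀ j, ∃ l, Tendsto (fun k => (A ^ k) i j) atTop (𝓝 l) := fun j => by
    simpa [trajectory_eq_pow_mulVec] using tendsto_trajectory_of_isAperiodicSet hA
      (isClosedSet_isOblivious hlam) hG (Pi.single j 1) i hi
  have hClim : ∀ v, ∃ l, Tendsto (fun k => (C ^ k) u v) atTop (𝓝 l) := fun v => by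
    simpa [trajectory_eq_pow_mulVec] using tendsto_trajectory_of_isAperiodicSet hC
      (O := Set.univ) (fun _ _ _ _ => Set.mem_univ _) (fun S hS hc _ => hT S hS hc)
      (Pi.single v 1) u (Set.mem_univ u)
  choose a ha using hAlim
  choose c hc using hClim
  refine ⟨∑ j, ∑ v, a j * c v * x (Sum.inl (j, v)), ?_⟩
  simp only [trajectory_systemMatrix_inl hA hlam x _ hi u]
  exact tendsto_finsetSum _ fun j _ => tendsto_finsetSum _ fun v _ =>
    ((ha j).mul (hc v)).mul_const _

/-- If all agents start with the same beliefs, the rows of `A ^ k` sum out and an oblivious agent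
displays the trajectory of `C` alone. -/
lemma logicCondition_of_convergesFromInitialBeliefs (hA : A ∈ rowStochastic ℝ V)
    (hC : C ∈ rowStochastic ℝ W) (hlam : ∀ i, lam i ∈ Set.Icc (0 : ℝ) 1)
    (ho : ∃ i, IsOblivious A lam i)
    (h : ConvergesFromInitialBeliefs A C lam) : LogicCondition C := by
  obtain ⟨i, hi⟩ := ho
  refine fun S hS hc => isAperiodicSet_of_tendsto_trajectory hC hS hc fun y hy u _ => ?_
  obtain ⟨l, hl⟩ := h (fun s => y s.2) fun s => hy s.2
  refine ⟨l (Sum.inl (i, u)), (tendsto_pi_nhds.1 hl (Sum.inl (i, u))).congr fun k => ?_⟩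
  rw [trajectory_systemMatrix_inl hA hlam _ _ hi, trajectory_eq_pow_mulVec]
  simp only [Sum.elim_inl, mul_assoc, ← Finset.mul_sum, ← Finset.sum_mul,
    sum_row_of_mem_rowStochastic (pow_mem hA k), one_mul]
  rfl

/-- Dually, beliefs equal across statements sum out `C ^ k`; one statement suffices to observe `A`.
-/
lemma socialCondition_of_convergesFromInitialBeliefs [Nonempty W] (hA : A ∈ rowStochastic ℝ V)
    (hC : C ∈ rowStochastic ℝ W) (hlam : ∀ i, lam i ∈ Set.Icc (0 : ℝ) 1)
    (h : ConvergesFromInitialBeliefs A C lam) :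
    SocialCondition A lam := by
  obtain ⟨u⟩ := ‹Nonempty W›
  refine fun S hS hc hSo => isAperiodicSet_of_tendsto_trajectory hA hS hc fun y hy i hi => ?_
  obtain ⟨l, hl⟩ := h (fun s => y s.1) fun s => hy s.1
  refine ⟨l (Sum.inl (i, u)), (tendsto_pi_nhds.1 hl (Sum.inl (i, u))).congr fun k => ?_⟩
  rw [trajectory_systemMatrix_inl hA hlam _ _ (hSo i hi), trajectory_eq_pow_mulVec]
  simp only [Sum.elim_inl, ← Finset.mul_sum, ← Finset.sum_mul,
    sum_row_of_mem_rowStochastic (pow_mem hC k), mul_one]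
  rfl

lemma ConvergesToEquilibrium.convergesFromInitialBeliefs (h : ConvergesToEquilibrium A C lam) :
    ConvergesFromInitialBeliefs A C lam :=
  fun b hb => h _ (by rintro (s | s) <;> exact hb s)

end System

end BeliefSystem

theorem mainTheorem1 {V W : Type*} [Fintype V] [DecidableEq V] [Fintype W] [DecidableEq W]
    [Nonempty W] (A : Matrix V V ℝ) (C : Matrix W W ℝ) (lam : V → ℝ)
    (hA : A ∈ Matrix.rowStochastic ℝ V) (hC : C ∈ Matrix.rowStochastic ℝ W)
    (hlam : ∀ i, lam i ∈ Set.Icc (0 : ℝ) 1) :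
    ((∃ i, BeliefSystem.IsOblivious A lam i) →
      (BeliefSystem.ConvergesToEquilibrium A C lam ↔
        BeliefSystem.LogicCondition C ∧ BeliefSystem.SocialCondition A lam) ∧
      (BeliefSystem.ConvergesFromInitialBeliefs A C lam ↔
        BeliefSystem.LogicCondition C ∧ BeliefSystem.SocialCondition A lam)) ∧
    ((¬ ∃ i, BeliefSystem.IsOblivious A lam i) →
      BeliefSystem.ConvergesToEquilibrium A C lam) := by
  refine ⟨fun ho => ?_, fun ho => BeliefSystem.convergesToEquilibrium_of_isOblivious hA hC hlam
    fun x i u hi => (ho ⟨i, hi⟩).elim⟩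
  have hsuff : BeliefSystem.LogicCondition C ∧ BeliefSystem.SocialCondition A lam →
      BeliefSystem.ConvergesToEquilibrium A C lam := fun h =>
    BeliefSystem.convergesToEquilibrium_of_conditions hA hC hlam h.1 h.2
  have hnec : BeliefSystem.ConvergesFromInitialBeliefs A C lam →
      BeliefSystem.LogicCondition C ∧ BeliefSystem.SocialCondition A lam := fun h =>
    ⟨BeliefSystem.logicCondition_of_convergesFromInitialBeliefs hA hC hlam ho h,
      BeliefSystem.socialCondition_of_convergesFromInitialBeliefs hA hC hlam h⟩
  exact ⟨⟨fun h => hnec h.convergesFromInitialBeliefs, hsuff⟩,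
    ⟨hnec, fun h => (hsuff h).convergesFromInitialBeliefs⟩⟩
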